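/- Let $M$ be a smooth $2$-manifold, let $(N,g)$ be a smooth Riemannian $3$-manifold, and let $f\colon M\to N$ be a $C^\infty$-map that has a cross cap at $p\in M$; that is, there are smooth local coordinates $\varphi=(u,v)$ of $M$ centered at $p$ and $\psi$ of $N$ centered at $f(p)$ such that $\psi\circ f\circ\varphi^{-1}(u,v)=(u,uv,v^2)$ near the origin. Call $q\in M$ an umbilical point of $f$ if $f$ is an immersion at $q$ and the second fundamental form of $f$ at $q$ (with respect to a unit normal vector and the Levi-Civita connection of $g$) is a scalar multiple of the first fundamental form at $q$. Then the umbilical points of $f$ do not accumulate at $p$: there is a neighborhood $W$ of $p$ such that no point of $W\setminus\{p\}$ is an umbilical point of $f$. -/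

import Mathlib

open scoped Manifold ContDiff Topology

noncomputable section

namespace CrossCap

/-- The coordinate plane. -/
abbrev E2 : Type := EuclideanSpace ℝ (Fin 2)

/-- The coordinate 3-space. -/
abbrev E3 : Type := EuclideanSpace ℝ (Fin 3)

/-- The standard cross cap `(u, v) ↦ (u, u v, v²)`. -/
def std (x : E2) : E3 := !₂[x 0, x 0 * x 1, x 1 ^ 2]

section Maps

variable {M : Type*} [TopologicalSpace M] [ChartedSpace E2 M]
  {N : Type*} [TopologicalSpace N] [ChartedSpace E3 N]

/-- `f` has a cross cap (Whitney umbrella) at `p`: there are smooth local coordinates `φ` of the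
surface centred at `p` and `ψ` of the 3-manifold centred at `f p` such that `ψ ∘ f = std ∘ φ`
near `p`. -/
def IsCrossCapAt (f : M → N) (p : M) : Prop :=
  ∃ φ ∈ IsManifold.maximalAtlas (𝓡 2) ∞ M, ∃ ψ ∈ IsManifold.maximalAtlas (𝓡 3) ∞ N,
    p ∈ φ.source ∧ φ p = 0 ∧ f p ∈ ψ.source ∧ ψ (f p) = 0 ∧
    ∀ᶠ q in 𝓝 p, ψ (f q) = std (φ q)

/-- The expression `ψ ∘ f ∘ φ⁻¹` of `f` in local coordinates. -/
def localMap (φ : OpenPartialHomeomorph M E2) (ψ : OpenPartialHomeomorph N E3) (f : M → N) :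
    E2 → E3 :=
  fun x => ψ (f (φ.symm x))

variable [IsManifold (𝓡 3) ∞ N]

/-- A smooth Riemannian metric on the 3-manifold `N`. -/
abbrev Metric (N : Type*) [TopologicalSpace N] [ChartedSpace E3 N] [IsManifold (𝓡 3) ∞ N] :
    Type _ :=
  Bundle.ContMDiffRiemannianMetric (𝓡 3) ∞ E3 (fun x : N => TangentSpace (𝓡 3) x)

/-- The metric `g` in the coordinates `ψ`: the pull-back of `g` by `ψ⁻¹`, evaluated at the
coordinate point `y` on the vectors `a`, `b`. -/
def localMetric (g : Metric N) (ψ : OpenPartialHomeomorph N E3) (y a b : E3) : ℝ :=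
  g.inner (ψ.symm y) (mfderiv (𝓡 3) (𝓡 3) ψ.symm y a) (mfderiv (𝓡 3) (𝓡 3) ψ.symm y b)

/-- The Christoffel symbols of the first kind of the Levi-Civita connection `D` of `g` in the
coordinates `ψ`, as a trilinear form: `g (D_a b, c)` for the constant coordinate fields
`a`, `b`, `c`. -/
def christoffel (g : Metric N) (ψ : OpenPartialHomeomorph N E3) (y a b c : E3) : ℝ :=
  (fderiv ℝ (fun z => localMetric g ψ z b c) y a
    + fderiv ℝ (fun z => localMetric g ψ z a c) y b
    - fderiv ℝ (fun z => localMetric g ψ z a b) y c) / 2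

/-- The first fundamental form of `f` in the coordinates `φ`, `ψ`, at the coordinate point `x`. -/
def firstForm (g : Metric N) (φ : OpenPartialHomeomorph M E2) (ψ : OpenPartialHomeomorph N E3)
    (f : M → N) (x X Y : E2) : ℝ :=
  localMetric g ψ (localMap φ ψ f x) (fderiv ℝ (localMap φ ψ f) x X)
    (fderiv ℝ (localMap φ ψ f) x Y)

/-- The second fundamental form `g (D_X (df Y), ν)` of `f` with respect to the normal vector `ν`,
in the coordinates `φ`, `ψ`, at the coordinate point `x`. Here `X`, `Y` are constant coordinate
fields and `D` is the Levi-Civita connection of `g` along `f`. -/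
def secondForm (g : Metric N) (φ : OpenPartialHomeomorph M E2) (ψ : OpenPartialHomeomorph N E3)
    (f : M → N) (x : E2) (ν : E3) (X Y : E2) : ℝ :=
  localMetric g ψ (localMap φ ψ f x) (fderiv ℝ (fderiv ℝ (localMap φ ψ f)) x X Y) ν
    + christoffel g ψ (localMap φ ψ f x) (fderiv ℝ (localMap φ ψ f) x X)
        (fderiv ℝ (localMap φ ψ f) x Y) ν

/-- `ν` is a unit normal vector of `f` at the coordinate point `x`. -/
def IsUnitNormal (g : Metric N) (φ : OpenPartialHomeomorph M E2) (ψ : OpenPartialHomeomorph N E3)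
    (f : M → N) (x : E2) (ν : E3) : Prop :=
  localMetric g ψ (localMap φ ψ f x) ν ν = 1 ∧
    ∀ X : E2, localMetric g ψ (localMap φ ψ f x) (fderiv ℝ (localMap φ ψ f) x X) ν = 0

/-- `q` is an umbilical point of `f`: `f` is an immersion at `q` and, in local coordinates, the
second fundamental form at `q` is a multiple of the first one, that is, the shape operator is a
multiple of the identity. Both forms are tensors, so the condition is the same in all smooth
coordinates `φ` around `q` and `ψ` around `f q`. -/
def IsUmbilicalPoint (g : Metric N) (f : M → N) (q : M) : Prop :=
  Function.Injective (mfderiv (𝓡 2) (𝓡 3) f q) ∧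
  ∀ φ ∈ IsManifold.maximalAtlas (𝓡 2) ∞ M, ∀ ψ ∈ IsManifold.maximalAtlas (𝓡 3) ∞ N,
    q ∈ φ.source → f q ∈ ψ.source →
    ∃ ν : E3, IsUnitNormal g φ ψ f (φ q) ν ∧
      ∃ c : ℝ, ∀ X Y : E2, secondForm g φ ψ f (φ q) ν X Y = c * firstForm g φ ψ f (φ q) X Y

end Maps

end CrossCap

end

noncomputable section

namespace CrossCap

set_option maxSynthPendingDepth 3

/-! ### Derivatives of the standard cross cap -/

/-! In cross-cap coordinates put `U = f_u = (1, v, 0)`, `V = f_v = (0, u, 2v)` and `r = ‖(u, v)‖`.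
Then `f_uu = 0`, `f_uv = e 1`, `f_vv = 2 • e 2`, and `V = O(r)` while `‖U‖ ≥ 1`. Suppose II = c I
with unit normal `ν`. The `UU` equation has only a Christoffel term on the left, so `c` is bounded.
The `UV` and `VV` equations then make `G (e 1) ν` and `G (e 2) ν` of size `O(r)`, and `G U ν = 0`
does the same for `G (e 0) ν`. Hence `1 = G ν ν = O(r)`, impossible for small `r`.

`exists_radius_not_umbilical` makes this quantitative for any metric with bounded coefficients;
`eventually_coercive` and `contDiffOn_localMetricCLM` supply the bounds near `f p`. -/

lemma contDiff_std : ContDiff ℝ ∞ std := by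
  refine contDiff_euclidean.2 fun i => ?_
  fin_cases i <;> simp [std] <;> fun_prop

lemma fderiv_std_apply (x X : E2) :
    fderiv ℝ std x X = !₂[X 0, x 0 * X 1 + X 0 * x 1, 2 * x 1 * X 1] := by
  have hd : DifferentiableAt ℝ std x := contDiff_std.differentiable (by simp) x
  have hi (i : Fin 2) : HasFDerivAt (fun z : E2 => z i) (EuclideanSpace.proj (𝕜 := ℝ) i) x :=
    (EuclideanSpace.proj (𝕜 := ℝ) i : E2 →L[ℝ] ℝ).hasFDerivAt
  have hc (i : Fin 3) := (EuclideanSpace.proj (𝕜 := ℝ) i : E3 →L[ℝ] ℝ).hasFDerivAt.comp x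
    hd.hasFDerivAt
  ext i
  fin_cases i
  · simpa using DFunLike.congr_fun ((hc 0).unique (hi 0)) X
  · simpa [mul_comm] using DFunLike.congr_fun ((hc 1).unique ((hi 0).mul (hi 1))) X
  · simpa using DFunLike.congr_fun ((hc 2).unique ((hi 1).pow 2)) X

lemma fderiv_fderiv_std_apply (x X Y : E2) :
    fderiv ℝ (fderiv ℝ std) x X Y = !₂[0, X 0 * Y 1 + Y 0 * X 1, 2 * X 1 * Y 1] := by
  have hd : DifferentiableAt ℝ (fderiv ℝ std) x :=
    (contDiff_std.fderiv_right (m := 1) (by norm_cast)).differentiable (by simp) x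
  have hi (i : Fin 2) : HasFDerivAt (fun z : E2 => z i) (EuclideanSpace.proj (𝕜 := ℝ) i) x :=
    (EuclideanSpace.proj (𝕜 := ℝ) i : E2 →L[ℝ] ℝ).hasFDerivAt
  have h1 : HasFDerivAt (fun z => fderiv ℝ std z Y) ((fderiv ℝ (fderiv ℝ std) x).flip Y) x := by
    simpa using hd.hasFDerivAt.clm_apply (hasFDerivAt_const Y x)
  simp only [fderiv_std_apply] at h1
  have hc (i : Fin 3) := (EuclideanSpace.proj (𝕜 := ℝ) i : E3 →L[ℝ] ℝ).hasFDerivAt.comp x h1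
  ext i
  fin_cases i
  · simpa using DFunLike.congr_fun ((hc 0).unique (hasFDerivAt_const (Y 0) x)) X
  · simpa [mul_comm] using DFunLike.congr_fun
      ((hc 1).unique (((hi 0).mul_const (Y 1)).add ((hi 1).const_mul (Y 0)))) X
  · simpa [mul_comm, mul_left_comm, mul_assoc] using DFunLike.congr_fun
      ((hc 2).unique (((hi 1).const_mul 2).mul_const (Y 1))) X

/-! ### The metric in coordinates -/

variable {N : Type*} [TopologicalSpace N] [ChartedSpace E3 N] [IsManifold (𝓡 3) ∞ N]

/-- The metric in the coordinates `ψ`, as a field of continuous bilinear forms. -/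
def localMetricCLM (g : Metric N) (ψ : OpenPartialHomeomorph N E3) (y : E3) :
    E3 →L[ℝ] E3 →L[ℝ] ℝ :=
  let B : E3 →L[ℝ] E3 →L[ℝ] ℝ := g.inner (ψ.symm y)
  let A : E3 →L[ℝ] E3 := mfderiv (𝓡 3) (𝓡 3) ψ.symm y
  B.bilinearComp A A

lemma localMetricCLM_apply (g : Metric N) (ψ : OpenPartialHomeomorph N E3) (y a b : E3) :
    localMetricCLM g ψ y a b = localMetric g ψ y a b := rfl

/-- Constant fields pushed forward by the tangent map of `ψ.symm` are `C^1` along `ψ.symm`, and the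
metric is evaluated on two of them. Order 1 suffices, since Christoffel symbols use only first
derivatives. -/
lemma contDiffOn_localMetric (g : Metric N) {ψ : OpenPartialHomeomorph N E3}
    (hψ : ψ ∈ IsManifold.maximalAtlas (𝓡 3) ∞ N) (a b : E3) :
    ContDiffOn ℝ 1 (fun y => localMetric g ψ y a b) ψ.target := by
  have : IsManifold (𝓡 3) 1 N := IsManifold.of_le (n := ∞) (by norm_cast)
  have hs := contMDiffOn_symm_of_mem_maximalAtlas hψ
  have hT := hs.contMDiffOn_tangentMapWithin (m := 1) (by norm_cast)
    ψ.open_target.uniqueMDiffOn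
  have hv (a : E3) : ContMDiffOn (𝓡 3) (𝓡 3).tangent 1
      (fun y => (⟨ψ.symm y, mfderiv (𝓡 3) (𝓡 3) ψ.symm y a⟩ : TangentBundle (𝓡 3) N))
      ψ.target := by
    have hc : ContMDiffOn (𝓡 3) (𝓡 3).tangent 1
        (fun y => (⟨y, a⟩ : TangentBundle (𝓡 3) E3)) ψ.target :=
      contMDiffOn_vectorSpace_iff_contDiffOn.2 contDiffOn_const
    refine (hT.comp hc fun y hy => hy).congr fun y hy => ?_
    simp [tangentMapWithin, mfderivWithin_of_isOpen ψ.open_target hy]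
  intro y hy
  have : ContMDiffWithinAt (𝓡 3) ((𝓡 3).prod 𝓘(ℝ)) 1
      (fun y ↦ Bundle.TotalSpace.mk' ℝ (E := Bundle.Trivial N ℝ) (ψ.symm y)
        (localMetric g ψ y a b)) ψ.target y := by
    apply ContMDiffWithinAt.clm_bundle_apply₂ (F₁ := E3) (F₂ := E3)
    · exact ((g.contMDiff.of_le (by norm_cast)).contMDiffAt).comp_contMDiffWithinAt y
        ((hs y hy).of_le (by norm_cast))
    · exact hv a y hy
    · exact hv b y hy
  simp only [Bundle.contMDiffWithinAt_totalSpace] at this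
  exact this.2.contDiffWithinAt

lemma contDiffOn_localMetricCLM (g : Metric N) {ψ : OpenPartialHomeomorph N E3}
    (hψ : ψ ∈ IsManifold.maximalAtlas (𝓡 3) ∞ N) :
    ContDiffOn ℝ 1 (localMetricCLM g ψ) ψ.target :=
  contDiffOn_clm_apply.2 fun a => contDiffOn_clm_apply.2 fun b => contDiffOn_localMetric g hψ a b

lemma localMetric_self_pos (g : Metric N) {ψ : OpenPartialHomeomorph N E3}
    (hψ : ψ ∈ IsManifold.maximalAtlas (𝓡 3) ∞ N) {y : E3} (hy : y ∈ ψ.target) {a : E3}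
    (ha : a ≠ 0) : 0 < localMetric g ψ y a a := by
  have hd : ψ.MDifferentiable (𝓡 3) (𝓡 3) :=
    ⟨(contMDiffOn_of_mem_maximalAtlas hψ).mdifferentiableOn (by simp),
      (contMDiffOn_symm_of_mem_maximalAtlas hψ).mdifferentiableOn (by simp)⟩
  refine g.pos _ _ fun h => ha ?_
  exact hd.symm.mfderiv_injective hy (h.trans (map_zero _).symm)

lemma christoffel_eq (g : Metric N) {ψ : OpenPartialHomeomorph N E3} {y : E3}
    (h : DifferentiableAt ℝ (localMetricCLM g ψ) y) (a b c : E3) :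
    christoffel g ψ y a b c = (fderiv ℝ (localMetricCLM g ψ) y a b c
      + fderiv ℝ (localMetricCLM g ψ) y b a c - fderiv ℝ (localMetricCLM g ψ) y c a b) / 2 := by
  have key (a b c : E3) : fderiv ℝ (fun z => localMetric g ψ z b c) y a =
      fderiv ℝ (localMetricCLM g ψ) y a b c := by
    have h1 := (h.hasFDerivAt.clm_apply (hasFDerivAt_const b y)).clm_apply (hasFDerivAt_const c y)
    simpa [localMetricCLM_apply] using DFunLike.congr_fun h1.fderiv a
  simp only [christoffel, key]

/-! ### Uniform bounds -/

/-- Compactness of the unit sphere gives coercivity at `t`; a perturbation of small operator norm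
costs at most half of the constant. -/
lemma eventually_coercive {V : Type*} [NormedAddCommGroup V] [NormedSpace ℝ V]
    [FiniteDimensional ℝ V] {T : Type*} [TopologicalSpace T] {G : T → V →L[ℝ] V →L[ℝ] ℝ} {t : T}
    (hG : ContinuousAt G t) (hpos : ∀ a, a ≠ 0 → 0 < G t a a) :
    ∃ m > 0, ∀ᶠ s in 𝓝 t, ∀ a, m * ‖a‖ ^ 2 ≤ G s a a := by
  obtain ⟨m, hm, h⟩ : ∃ m > 0, ∀ a, 2 * m * ‖a‖ ^ 2 ≤ G t a a := by
    have hcont : Continuous fun a => G t a a := by fun_prop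
    rcases (Metric.sphere (0 : V) 1).eq_empty_or_nonempty with he | hne
    · refine ⟨1, one_pos, fun a => ?_⟩
      rcases eq_or_ne a 0 with rfl | ha
      · simp
      · have : (‖a‖⁻¹ • a) ∈ Metric.sphere (0 : V) 1 := by simp [norm_smul, ha]
        simp [he] at this
    · obtain ⟨b, hb, hmin⟩ := (isCompact_sphere (0 : V) 1).exists_isMinOn hne hcont.continuousOn
      have hb0 : b ≠ 0 := by
        rintro rfl
        simp at hb
      refine ⟨G t b b / 2, half_pos (hpos b hb0), fun a => ?_⟩
      rcases eq_or_ne a 0 with rfl | ha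
      · simp
      · have hn : ‖a‖ ≠ 0 := norm_ne_zero_iff.2 ha
        have := hmin (show (‖a‖⁻¹ • a) ∈ Metric.sphere (0 : V) 1 by simp [norm_smul, ha])
        simp only [Set.mem_ofPred_eq, map_smul, smul_apply, smul_eq_mul] at this
        calc 2 * (G t b b / 2) * ‖a‖ ^ 2 = G t b b * ‖a‖ ^ 2 := by ring
          _ ≤ (‖a‖⁻¹ * (‖a‖⁻¹ * G t a a)) * ‖a‖ ^ 2 := by gcongr
          _ = G t a a := by field_simp
  refine ⟨m, hm, ?_⟩
  have hlim : ContinuousAt (fun s => ‖G s - G t‖) t := (hG.sub continuousAt_const).norm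
  filter_upwards [hlim.eventually_lt_const (u := m) (by simpa using hm)] with s hs a
  have h1 : |(G s - G t) a a| ≤ m * ‖a‖ * ‖a‖ := by
    refine ((G s - G t).le_opNorm₂ a a).trans ?_
    have := hs.le
    gcongr
  have h2 := (abs_le.1 h1).1
  simp only [sub_apply] at h2
  nlinarith [h a]

/-- The Christoffel expression formed from the derivative `D` of a metric. -/
def christoffelOf {V : Type*} [NormedAddCommGroup V] [NormedSpace ℝ V]
    (D : V →L[ℝ] V →L[ℝ] V →L[ℝ] ℝ) (a b c : V) : ℝ :=
  (D a b c + D b a c - D c a b) / 2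

lemma abs_christoffelOf_le {V : Type*} [NormedAddCommGroup V] [NormedSpace ℝ V]
    {D : V →L[ℝ] V →L[ℝ] V →L[ℝ] ℝ} {K : ℝ} (hD : ‖D‖ ≤ K) (a b c : V) :
    |christoffelOf D a b c| ≤ 2 * K * ‖a‖ * ‖b‖ * ‖c‖ := by
  have h (a b c : V) : |D a b c| ≤ K * ‖a‖ * ‖b‖ * ‖c‖ := by
    refine ((D a).le_opNorm₂ b c).trans ?_
    gcongr
    exact D.le_of_opNorm_le hD a
  have h1 := abs_le.1 (h a b c)
  have h2 := abs_le.1 (h b a c)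
  have h3 := abs_le.1 (h c a b)
  have h0 : 0 ≤ K * ‖a‖ * ‖b‖ * ‖c‖ := (abs_nonneg _).trans (h a b c)
  have e2 : K * ‖b‖ * ‖a‖ * ‖c‖ = K * ‖a‖ * ‖b‖ * ‖c‖ := by ring
  have e3 : K * ‖c‖ * ‖a‖ * ‖b‖ = K * ‖a‖ * ‖b‖ * ‖c‖ := by ring
  rw [e2] at h2
  rw [e3] at h3
  rw [christoffelOf, abs_le]
  constructor <;> linarith [h1.1, h1.2, h2.1, h2.2, h3.1, h3.2]

/-- Near the origin, the second fundamental form of the standard cross cap is not a multiple of the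
first one, uniformly for metrics with bounded coefficients. -/
lemma exists_radius_not_umbilical {m K : ℝ} (hm : 0 < m) (hK : 0 ≤ K) :
    ∃ δ > 0, ∀ (G : E3 →L[ℝ] E3 →L[ℝ] ℝ) (D : E3 →L[ℝ] E3 →L[ℝ] E3 →L[ℝ] ℝ) (x : E2) (ν : E3)
      (c : ℝ), (∀ a, m * ‖a‖ ^ 2 ≤ G a a) → ‖G‖ ≤ K → ‖D‖ ≤ K → ‖x‖ < δ → G ν ν = 1 →
      (∀ X, G (fderiv ℝ std x X) ν = 0) →
      ¬ ∀ X Y, G (fderiv ℝ (fderiv ℝ std) x X Y) ν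
          + christoffelOf D (fderiv ℝ std x X) (fderiv ℝ std x Y) ν
        = c * G (fderiv ℝ std x X) (fderiv ℝ std x Y) := by
  -- `B` will bound `‖ν‖`, `C` will bound `|c|`, and `S * r` will bound `G ν ν`: 42 = 12 + 12 + 18
  -- and 21 = 6 + 6 + 9 add up the three estimates `hn0`, `hn1`, `hn2`.
  set B : ℝ := 1 / m + 1 with hB
  have hB0 : 0 < B := by positivity
  set C : ℝ := 8 * K * B / m with hC
  have hC0 : 0 ≤ C := by positivity
  set S : ℝ := B * (42 * K * B + 21 * C * K) with hS
  have hS0 : 0 ≤ S := by positivity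
  refine ⟨1 / (S + 1), by positivity, fun G D x ν c hG hGK hDK hx hν hn humb => ?_⟩
  set r := ‖x‖ with hr
  have hr0 : 0 ≤ r := norm_nonneg x
  have hSr : (S + 1) * r < 1 := by
    rw [lt_div_iff₀ (by positivity)] at hx
    linarith
  have hr1 : r ≤ 1 := by nlinarith [mul_nonneg hS0 hr0]
  have hu : |x 0| ≤ r := PiLp.norm_apply_le x 0
  have hv : |x 1| ≤ r := PiLp.norm_apply_le x 1
  have hνB : ‖ν‖ ≤ B := by
    have h1 := hG ν
    rw [hν] at h1
    have h2 : ‖ν‖ ^ 2 ≤ 1 / m := by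
      rw [le_div_iff₀ hm]
      linarith
    nlinarith [sq_nonneg (‖ν‖ - 1), norm_nonneg ν]
  let e (i : Fin 3) : E3 := EuclideanSpace.single i 1
  have he (i : Fin 3) : ‖e i‖ = 1 := by simp [e]
  set U : E3 := fderiv ℝ std x (EuclideanSpace.single 0 1) with hU
  set V : E3 := fderiv ℝ std x (EuclideanSpace.single 1 1) with hV
  have hUe : U = e 0 + x 1 • e 1 := by
    rw [hU, fderiv_std_apply]
    ext i
    fin_cases i <;> simp [e]
  have hVe : V = x 0 • e 1 + (2 * x 1) • e 2 := by
    rw [hV, fderiv_std_apply]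
    ext i
    fin_cases i <;> simp [e]
  have hUV : fderiv ℝ (fderiv ℝ std) x (EuclideanSpace.single 0 1) (EuclideanSpace.single 1 1)
      = e 1 := by
    rw [fderiv_fderiv_std_apply]
    ext i
    fin_cases i <;> simp [e]
  have hUU : fderiv ℝ (fderiv ℝ std) x (EuclideanSpace.single 0 1) (EuclideanSpace.single 0 1)
      = 0 := by
    rw [fderiv_fderiv_std_apply]
    ext i
    fin_cases i <;> simp
  have hVV : fderiv ℝ (fderiv ℝ std) x (EuclideanSpace.single 1 1) (EuclideanSpace.single 1 1)
      = (2 : ℝ) • e 2 := by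
    rw [fderiv_fderiv_std_apply]
    ext i
    fin_cases i <;> simp [e]
  have hUle : ‖U‖ ≤ 2 := by
    rw [hUe]
    refine (norm_add_le _ _).trans ?_
    rw [norm_smul, he, he, Real.norm_eq_abs]
    linarith
  have hUge : 1 ≤ ‖U‖ := by
    have := PiLp.norm_apply_le U 0
    simpa [hUe, e] using this
  have hVle : ‖V‖ ≤ 3 * r := by
    rw [hVe]
    refine (norm_add_le _ _).trans ?_
    rw [norm_smul, norm_smul, he, he, Real.norm_eq_abs, Real.norm_eq_abs, abs_mul, abs_two]
    linarith
  have hGle (a b : E3) : |G a b| ≤ K * ‖a‖ * ‖b‖ := by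
    refine (G.le_opNorm₂ a b).trans ?_
    gcongr
  have eUU := humb (EuclideanSpace.single 0 1) (EuclideanSpace.single 0 1)
  have eUV := humb (EuclideanSpace.single 0 1) (EuclideanSpace.single 1 1)
  have eVV := humb (EuclideanSpace.single 1 1) (EuclideanSpace.single 1 1)
  rw [hUU, ← hU, map_zero, zero_apply, zero_add] at eUU
  rw [hUV, ← hU, ← hV] at eUV
  rw [hVV, ← hV, map_smul, smul_apply, smul_eq_mul] at eVV
  -- The `UU` equation reads `christoffelOf D U U ν = c * G U U`, with `G U U ≥ m`.
  have hcC : |c| ≤ C := by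
    have h1 : |c| * m ≤ |c * G U U| := by
      rw [abs_mul]
      gcongr
      refine le_trans ?_ (le_abs_self _)
      have : 1 ≤ ‖U‖ ^ 2 := one_le_pow₀ hUge
      exact (le_mul_of_one_le_right hm.le this).trans (hG U)
    have h2 : |christoffelOf D U U ν| ≤ 2 * K * 2 * 2 * B := by
      refine (abs_christoffelOf_le hDK U U ν).trans ?_
      gcongr
    rw [hC, le_div_iff₀ hm]
    rw [← eUU] at h1
    linarith
  have hn1 : |G (e 1) ν| ≤ (12 * K * B + 6 * C * K) * r := by
    have h1 : |christoffelOf D U V ν| ≤ 2 * K * 2 * (3 * r) * B := by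
      refine (abs_christoffelOf_le hDK U V ν).trans ?_
      gcongr
    have h2 : |c * G U V| ≤ C * (K * 2 * (3 * r)) := by
      rw [abs_mul]
      gcongr
      refine (hGle U V).trans ?_
      gcongr
    rw [eq_sub_of_add_eq eUV]
    refine (abs_sub _ _).trans ?_
    linarith
  have hn2 : |G (e 2) ν| ≤ (18 * K * B + 9 * C * K) * r := by
    have hrr : r * r ≤ r := mul_le_of_le_one_left hr0 hr1
    have h1 : |christoffelOf D V V ν| ≤ 2 * K * (3 * r) * (3 * r) * B := by
      refine (abs_christoffelOf_le hDK V V ν).trans ?_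
      gcongr
    have h2 : |c * G V V| ≤ C * (K * (3 * r) * (3 * r)) := by
      rw [abs_mul]
      gcongr
      refine (hGle V V).trans ?_
      gcongr
    have h3 : |2 * G (e 2) ν| ≤ (18 * K * B + 9 * C * K) * (r * r) := by
      rw [eq_sub_of_add_eq eVV]
      refine (abs_sub _ _).trans ?_
      linarith
    have h4 : (18 * K * B + 9 * C * K) * (r * r) ≤ (18 * K * B + 9 * C * K) * r := by gcongr
    rw [abs_mul, abs_two] at h3
    linarith [abs_nonneg (G (e 2) ν)]
  -- Normality to `U = e 0 + v • e 1` gives `G (e 0) ν = -v * G (e 1) ν`, and `|v| ≤ 1`.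
  have hn0 : |G (e 0) ν| ≤ (12 * K * B + 6 * C * K) * r := by
    have h := hn (EuclideanSpace.single 0 1)
    rw [← hU, hUe, map_add, map_smul, add_apply, smul_apply, smul_eq_mul] at h
    rw [eq_neg_of_add_eq_zero_left h, abs_neg, abs_mul]
    exact (mul_le_of_le_one_left (abs_nonneg _) (hv.trans hr1)).trans hn1
  have hsum : ν = ν 0 • e 0 + ν 1 • e 1 + ν 2 • e 2 := by
    ext i
    fin_cases i <;> simp [e]
  have hexp : G ν ν = ν 0 * G (e 0) ν + ν 1 * G (e 1) ν + ν 2 * G (e 2) ν := by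
    have h := congrArg (fun a => G a ν) hsum
    simpa only [map_add, map_smul, add_apply, smul_apply, smul_eq_mul] using h
  have hterm (i : Fin 3) {s : ℝ} (hs : |G (e i) ν| ≤ s) : ν i * G (e i) ν ≤ B * s := by
    refine (le_abs_self _).trans ?_
    rw [abs_mul]
    have : |ν i| ≤ B := (PiLp.norm_apply_le ν i).trans hνB
    gcongr
  have t0 := hterm 0 hn0
  have t1 := hterm 1 hn1
  have t2 := hterm 2 hn2
  have : 1 ≤ S * r := by
    rw [← hν, hexp, hS]
    linarith
  linarith

/-! ### Umbilical points near a cross cap -/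

/-- Equality of germs, not just of values, is needed to replace the first and second derivatives of
`localMap` by those of `std`. -/
lemma eventually_localMap_eventuallyEq_std {M N : Type*} [TopologicalSpace M]
    [TopologicalSpace N] {φ : OpenPartialHomeomorph M E2}
    {ψ : OpenPartialHomeomorph N E3} {f : M → N} {p : M} (hp : p ∈ φ.source)
    (h : ∀ᶠ q in 𝓝 p, ψ (f q) = std (φ q)) :
    ∀ᶠ q in 𝓝 p, localMap φ ψ f =ᶠ[𝓝 (φ q)] std := by
  filter_upwards [eventually_eventually_nhds.2 h, φ.open_source.mem_nhds hp] with q hq hqs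
  have ht : Filter.Tendsto φ.symm (𝓝 (φ q)) (𝓝 q) := by
    simpa [φ.left_inv hqs] using (φ.continuousAt_symm (φ.map_source hqs)).tendsto
  filter_upwards [ht.eventually hq, φ.open_target.mem_nhds (φ.map_source hqs)] with x hx hxt
  rw [localMap, hx, φ.right_inv hxt]

lemma eventually_not_isUmbilicalPoint {M : Type*} [TopologicalSpace M] [ChartedSpace E2 M]
    {N : Type*} [TopologicalSpace N] [ChartedSpace E3 N] [IsManifold (𝓡 3) ∞ N]
    (g : Metric N) {f : M → N} {p : M} (hf : ContinuousAt f p)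
    (hp : IsCrossCapAt f p) : ∀ᶠ q in 𝓝 p, ¬ IsUmbilicalPoint g f q := by
  obtain ⟨φ, hφ, ψ, hψ, hpφ, hφp, hpψ, hψp, hstd⟩ := hp
  have h0 : (0 : E3) ∈ ψ.target := hψp ▸ ψ.map_source hpψ
  have hG : ContDiffAt ℝ 1 (localMetricCLM g ψ) 0 :=
    (contDiffOn_localMetricCLM g hψ).contDiffAt (ψ.open_target.mem_nhds h0)
  obtain ⟨m, hm, hcoer⟩ := eventually_coercive hG.continuousAt
    fun a ha => localMetric_self_pos g hψ h0 ha
  have hG' : ContinuousAt (fderiv ℝ (localMetricCLM g ψ)) 0 :=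
    (hG.fderiv_right (m := 0) (by norm_num)).continuousAt
  -- The extra 1 makes both bounds strict at the origin, so they persist nearby by continuity.
  set K := ‖localMetricCLM g ψ 0‖ + ‖fderiv ℝ (localMetricCLM g ψ) 0‖ + 1 with hKdef
  have hK : 0 ≤ K := by positivity
  have hGK : ∀ᶠ y in 𝓝 (0 : E3), ‖localMetricCLM g ψ y‖ < K :=
    hG.continuousAt.norm.eventually_lt_const (by
      linarith [norm_nonneg (fderiv ℝ (localMetricCLM g ψ) 0)])
  have hDK : ∀ᶠ y in 𝓝 (0 : E3), ‖fderiv ℝ (localMetricCLM g ψ) y‖ < K :=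
    hG'.norm.eventually_lt_const (by linarith [norm_nonneg (localMetricCLM g ψ 0)])
  have hdiff : ∀ᶠ y in 𝓝 (0 : E3), DifferentiableAt ℝ (localMetricCLM g ψ) y := by
    filter_upwards [hG.eventually (by simp)] with y hy using hy.differentiableAt (by simp)
  obtain ⟨δ, hδ, hrad⟩ := exists_radius_not_umbilical hm hK
  have hφt : Filter.Tendsto φ (𝓝 p) (𝓝 0) := hφp ▸ (φ.continuousAt hpφ).tendsto
  have hψt : Filter.Tendsto (fun q => ψ (f q)) (𝓝 p) (𝓝 0) :=
    hψp ▸ ((ψ.continuousAt hpψ).comp hf).tendsto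
  filter_upwards [φ.open_source.mem_nhds hpφ, hf (ψ.open_source.mem_nhds hpψ),
    eventually_localMap_eventuallyEq_std hpφ hstd,
    hφt.eventually (Metric.ball_mem_nhds 0 hδ), hψt.eventually hcoer, hψt.eventually hGK,
    hψt.eventually hDK, hψt.eventually hdiff] with q hqφ hqψ hloc hball hq1 hq2 hq3 hq4 hq
  obtain ⟨ν, ⟨hν1, hνn⟩, c, hc⟩ := hq.2 φ hφ ψ hψ hqφ hqψ
  have hval : localMap φ ψ f (φ q) = ψ (f q) := by rw [localMap, φ.left_inv hqφ]
  simp only [hval, hloc.fderiv_eq] at hν1 hνn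
  simp only [secondForm, firstForm, hval, hloc.fderiv_eq, hloc.fderiv.fderiv_eq,
    christoffel_eq g hq4] at hc
  exact hrad _ _ (φ q) ν c hq1 hq2.le hq3.le (by simpa using hball) hν1 hνn hc

end CrossCap

end

theorem mainTheorem7
    {M : Type*} [TopologicalSpace M] [ChartedSpace (EuclideanSpace ℝ (Fin 2)) M]
    [IsManifold (𝓡 2) ∞ M]
    {N : Type*} [TopologicalSpace N] [ChartedSpace (EuclideanSpace ℝ (Fin 3)) N]
    [IsManifold (𝓡 3) ∞ N]
    (g : CrossCap.Metric N) (f : M → N) (hf : ContMDiff (𝓡 2) (𝓡 3) ∞ f)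
    (p : M) (hp : CrossCap.IsCrossCapAt f p) :
    ¬ AccPt p (Filter.principal {q : M | CrossCap.IsUmbilicalPoint g f q}) := by
  rw [accPt_iff_frequently, Filter.not_frequently]
  filter_upwards [CrossCap.eventually_not_isUmbilicalPoint g hf.continuous.continuousAt hp]
    with q hq h using hq h.2
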